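/- \textbf{Setting.} Let $S^1=[-1,1]/(-1\sim 1)$, $T^2=S^1\times S^1$, and let $m$ be Lebesgue measure. \emph{Cantor sets.} Let $c\in\mathbb R$, $0<b<r$ and $\alpha_n>0$ ($n\ge1$) satisfy $\sum_{n\ge1}\alpha_n<2(r-b)$, $\alpha_{n+1}<\alpha_n$, $\alpha_{n+1}/\alpha_n\to1$, $\alpha_1<2b$. Start with the atom $[c-r,c+r]$ of generation $0$ (empty word). From each atom $I_w$ of generation $n$, $w\in\{0,1\}^n$, remove the open gap $I_w^*$ centred at its midpoint, of length $2b$ if $n=0$ and $\alpha_n/2^n$ if $n\ge1$; the closed intervals left are the atoms $I_{w0}$ (on the left) and $I_{w1}$ (on the right) of generation $n+1$. The Cantor set is $K=\bigcap_{n\ge1}\bigcup_{w\in\{0,1\}^n}I_w$. A \emph{Bowen map} for it is a map $G$ that is continuous on $I_0\cup I_1$ and maps each gap $I^*_{a_0a_1\dots a_n}$ onto $I^*_{a_1\dots a_n}$ as an increasing $C^1$ map with $G'>1$ and $G'\to2$ at both ends of the gap, such that, for some $\epsilon_n\to0$, $|G'-2|<\epsilon_n$ on all gaps of generation $n+1$,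 $n\ge1$. \emph{Circle maps.} For $k\ge1$, let $\mathcal B_k$ be the class of maps $g:S^1\to S^1$ that have a $C^1$ lift to $\mathbb R$ with derivative bounded below by some $\lambda>1$, together with $k$ Cantor sets $K_1,\dots,K_k\subset[-1,1]$ as above and Bowen maps $G_1,\dots,G_k$ for them, such that: $K_1$ is constructed in $[-1,1]$; for $i\ge2$ the interval $[c_i-r_i,c_i+r_i]$ in which $K_i$ is constructed is contained in a gap (of any generation, the host gap of $i$) of some $K_j$ with $j<i$; host gaps of different $i$ are different; and $g=G_i$ modulo $2\mathbb{Z}$ at every point of the two generation-one atoms of $K_i$ that lies in none of the gaps of $K_i$ chosen as host gaps. On a Cantor set $K\subset S^1$ put $\mu_K(B)=m(B\cap K)/m(K)$. Let $f_1\in\mathcal B_1$ with Cantor set $K_{S^1}$ and Bowen map $G$, let $f_2\in\mathcal B_k$ with Cantor sets $K_{1,S^1},\dots,K_{k,S^1}$ and Bowen maps $G_1,\dots,G_k$, and let $f(x,y)=(f_1(x),f_2(y))$ on $T^2$. For $1\le i\le k$ put $K_{i,T^2}=K_{S^1}\times K_{i,S^1}$ and $\mu_{K_{i,T^2}}=\mu_{K_{S^1}}\times\mu_{K_{i,S^1}}$.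 Let $\sigma(c_0c_1\dots)=c_1c_2\dots$ on $\{0,1,2,3\}^{\mathbb N}$ and let $\nu$ be the Bernoulli measure with weight $1/4$ for each symbol. An itinerary of $x\in K_{S^1}$ is a sequence $(a_n)$ in $\{0,1\}$ such that $f_1^n(x)$ lies in the generation-one atom $I_{a_n}$ of $K_{S^1}$ for all $n\geq 0$; likewise $(b_n)$ for $y\in K_{i,S^1}$ and $f_2$. The combined itinerary is $h(x,y)=(2a_n+b_n)_{n\ge0}$. The only ambiguity arises when an orbit hits the point $-1\sim1$, which is common to two atoms if the Cantor set is constructed in $[-1,1]$; on the circle it then gets the symbol $1$. \textbf{Proposition.} For every $i\in\{1,\dots,k\}$: (1) $\mu_{K_{i,T^2}}$ is an $f$-invariant Borel probability measure with $\mu_{K_{i,T^2}}(K_{i,T^2})=1$. (2) (Before identifying $-1$ with $1$.) Regard $K_{S^1}$ and $K_{i,S^1}$ as subsets of $[-1,1]$. The map $G\times G_i$ maps $K_{S^1}\times K_{i,S^1}$ into itself and induces $f$ there. The combined itinerary map $h$, defined with $G,G_i$ instead of $f_1,f_2$, is a bijection from $K_{S^1}\times K_{i,S^1}$ onto $\{0,1,2,3\}^{\mathbb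 N}$, measurable with measurable inverse, $h\circ(G\times G_i)=\sigma\circ h$, and $h$ carries the product of the normalized Lebesgue measures on the two Cantor sets to $\nu$. (3) (On the torus.) $h$ is measurable, gives itineraries at all points of $K_{i,T^2}$, satisfies $h\circ f=\sigma\circ h$ on $K_{i,T^2}$, and $h_*\mu_{K_{i,T^2}}=\nu$. Let $E$ be the set of points of $K_{i,T^2}$ none of whose iterates under $f$ has a coordinate equal to the point $-1\sim1$. Then $E$ is a Borel set, $f(E)\subset E$, $\mu_{K_{i,T^2}}(E)=1$, $h$ is injective on $E$, the image under $h$ of every Borel subset of $E$ is Borel, and $\nu(h(E))=1$. So $(f,\mu_{K_{i,T^2}})$ is conjugate, through the combined itinerary map, to the Bernoulli shift $(\sigma,\nu)$. -/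

import Mathlib

open Set Filter Topology MeasureTheory ProbabilityTheory

noncomputable section

namespace BowenTorus

/-- Needed for the Lebesgue measure on `AddCircle 2`. -/
instance factTwoPos : Fact ((0 : ℝ) < 2) := ⟨two_pos⟩

/-- The circle `[-1, 1] / (-1 ∼ 1)`; its `volume` is Lebesgue measure, of total mass `2`. -/
abbrev Circ : Type := AddCircle (2 : ℝ)

/-- The one-sided shift `(a₀ a₁ a₂ …) ↦ (a₁ a₂ …)`. -/
def shift {S : Type*} (a : ℕ → S) : ℕ → S := fun n => a (n + 1)

/-- The parameters of Bowen's construction of a Cantor set in the interval `[c - r, c + r]` with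
central gap `(c - b, c + b)`. Only `α n` with `1 ≤ n` is used: the gaps of generation `n` have total
length `α n`. -/
structure CantorData where
  c : ℝ
  r : ℝ
  b : ℝ
  α : ℕ → ℝ
  b_pos : 0 < b
  b_lt : b < r
  α_pos : ∀ n, 1 ≤ n → 0 < α n
  α_summable : Summable fun n => α (n + 1)
  α_sum : ∑' n, α (n + 1) < 2 * (r - b)
  α_anti : ∀ n, 1 ≤ n → α (n + 1) < α n
  α_ratio : Tendsto (fun n => α (n + 1) / α n) atTop (𝓝 1)
  α_one : α 1 < 2 * b

namespace CantorData

variable (P : CantorData)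

/-- The length of each of the `2 ^ n` gaps of generation `n`. -/
def gapLen : ℕ → ℝ
  | 0 => 2 * P.b
  | n + 1 => P.α (n + 1) / 2 ^ (n + 1)

/-- The pair (left end, right end) of the atom of generation `n` with word `a 0, …, a (n - 1)`
(the other entries of `a` play no role): remove the centred open gap from the previous atom, and
keep its left part for the symbol `0`, its right part for the symbol `1`. -/
def ends (a : ℕ → Fin 2) : ℕ → ℝ × ℝ
  | 0 => (P.c - P.r, P.c + P.r)
  | n + 1 =>
    if a n = 0 then
      ((ends a n).1, ((ends a n).1 + (ends a n).2) / 2 - P.gapLen n / 2)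
    else
      (((ends a n).1 + (ends a n).2) / 2 + P.gapLen n / 2, (ends a n).2)

/-- The atom of generation `n` with word `a 0, …, a (n - 1)`. -/
def atom (a : ℕ → Fin 2) (n : ℕ) : Set ℝ := Icc (P.ends a n).1 (P.ends a n).2

/-- Left end of the gap of generation `n` inside the atom with word `a 0, …, a (n - 1)`. -/
def gapLeft (a : ℕ → Fin 2) (n : ℕ) : ℝ :=
  ((P.ends a n).1 + (P.ends a n).2) / 2 - P.gapLen n / 2

/-- Right end of the gap of generation `n` inside the atom with word `a 0, …, a (n - 1)`. -/
def gapRight (a : ℕ → Fin 2) (n : ℕ) : ℝ :=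
  ((P.ends a n).1 + (P.ends a n).2) / 2 + P.gapLen n / 2

/-- The gap of generation `n` inside the atom with word `a 0, …, a (n - 1)`. -/
def gap (a : ℕ → Fin 2) (n : ℕ) : Set ℝ := Ioo (P.gapLeft a n) (P.gapRight a n)

/-- The two atoms of generation `1`, `I₀ = [c - r, c - b]` and `I₁ = [c + b, c + r]`. -/
def piece (e : Fin 2) : Set ℝ :=
  if e = 0 then Icc (P.c - P.r) (P.c - P.b) else Icc (P.c + P.b) (P.c + P.r)

/-- The Cantor set: the points that lie in some atom of each generation `n ≥ 1`. -/
def cantor : Set ℝ := ⋂ n : ℕ, ⋃ a : ℕ → Fin 2, P.atom a (n + 1)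

/-- The same Cantor set on the circle. -/
def cantorCirc : Set Circ := (fun x : ℝ => (x : Circ)) '' P.cantor

end CantorData

/-- `G` is a map obtained by Bowen's construction on `I₀ ∪ I₁`: it sends each gap of generation
`n + 1` onto the gap of generation `n` whose word is the shifted one, as an increasing expanding
`C¹` map with derivative tending to `2` at the ends of the gap and uniformly close to `2` on
gaps of high generation, and it extends continuously to `I₀ ∪ I₁`. -/
structure IsBowenMap (P : CantorData) (G : ℝ → ℝ) : Prop where
  cont : ContinuousOn G (P.piece 0 ∪ P.piece 1)
  smooth : ∀ a n, ContDiffOn ℝ 1 G (P.gap a (n + 1))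
  mono : ∀ a n, StrictMonoOn G (P.gap a (n + 1))
  surj : ∀ a n, G '' P.gap a (n + 1) = P.gap (shift a) n
  expanding : ∀ a n, ∀ x ∈ P.gap a (n + 1), 1 < deriv G x
  deriv_left : ∀ a n, Tendsto (deriv G) (𝓝[>] (P.gapLeft a (n + 1))) (𝓝 2)
  deriv_right : ∀ a n, Tendsto (deriv G) (𝓝[<] (P.gapRight a (n + 1))) (𝓝 2)
  deriv_near : ∃ ε : ℕ → ℝ, Tendsto ε atTop (𝓝 0) ∧
    ∀ n, 1 ≤ n → ∀ a, ∀ x ∈ P.gap a (n + 1), |deriv G x - 2| < ε n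

/-- An orientation-preserving expanding `C¹` map of the circle carrying `k` Cantor sets of Bowen
type. The set number `0` is constructed in the whole interval `[-1, 1]`. Each other one is
constructed in an interval `[c - r, c + r]` inside a gap (its host gap) of a set with smaller
number, distinct sets having distinct host gaps. Outside the host gaps contained in them, on the
two atoms of generation `1` of the `i`-th set the map is the `i`-th Bowen map. -/
structure BowenCircleMap (k : ℕ) [NeZero k] where
  /-- the circle map -/
  f : Circ → Circ
  /-- a lift of `f` to the line -/
  F : ℝ → ℝ
  lift : ∀ x : ℝ, f (x : Circ) = (F x : Circ)
  smooth : ContDiff ℝ 1 F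
  expanding : ∃ l : ℝ, 1 < l ∧ ∀ x, l ≤ deriv F x
  /-- the `k` Cantor constructions -/
  P : Fin k → CantorData
  /-- the `k` Bowen maps -/
  G : Fin k → ℝ → ℝ
  bowen : ∀ i, IsBowenMap (P i) (G i)
  center_zero : (P 0).c = 0
  radius_zero : (P 0).r = 1
  /-- the host gap of the `i`-th set, for `i ≠ 0`, is the gap of the set number `host i`, of
  generation `hostGen i`, with word `hostWord i` -/
  host : Fin k → Fin k
  hostGen : Fin k → ℕ
  hostWord : Fin k → ℕ → Fin 2
  host_lt : ∀ i, i ≠ 0 → host i < i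
  sub_host : ∀ i, i ≠ 0 → Icc ((P i).c - (P i).r) ((P i).c + (P i).r) ⊆
    (P (host i)).gap (hostWord i) (hostGen i)
  host_ne : ∀ i j, i ≠ 0 → j ≠ 0 → i ≠ j →
    (P (host i)).gap (hostWord i) (hostGen i) ≠ (P (host j)).gap (hostWord j) (hostGen j)
  agree : ∀ i, ∀ x ∈ (P i).piece 0 ∪ (P i).piece 1,
    (∀ j, j ≠ 0 → host j = i → x ∉ (P i).gap (hostWord j) (hostGen j)) →
      f (x : Circ) = (G i x : Circ)

/-- The `i`-th Cantor set of the map, on the circle. -/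
def BowenCircleMap.K {k : ℕ} [NeZero k] (Φ : BowenCircleMap k) (i : Fin k) : Set Circ :=
  (Φ.P i).cantorCirc

/-- Normalized Lebesgue measure `B ↦ m (B ∩ K) / m K` on the `i`-th Cantor set in the circle. -/
def BowenCircleMap.μ {k : ℕ} [NeZero k] (Φ : BowenCircleMap k) (i : Fin k) : Measure Circ :=
  ProbabilityTheory.cond volume (Φ.K i)

/-- The `i`-th atom of generation `1` with symbol `e`, on the circle. -/
def BowenCircleMap.pieceCirc {k : ℕ} [NeZero k] (Φ : BowenCircleMap k) (i : Fin k) (e : Fin 2) :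
    Set Circ := (fun x : ℝ => (x : Circ)) '' (Φ.P i).piece e

open Classical in
/-- The itinerary of `x`: the symbol at time `n` is `1` if `g^n x ∈ A`, and `0` otherwise. -/
def itin {X : Type*} (g : X → X) (A : Set X) (x : X) : ℕ → Fin 2 :=
  fun n => if g^[n] x ∈ A then 1 else 0

/-- The symbol of the four-letter alphabet that codes a pair of binary symbols:
`00 ↦ 0`, `01 ↦ 1`, `10 ↦ 2`, `11 ↦ 3`. -/
def pairSymbol (a b : Fin 2) : Fin 4 := ⟨2 * a.val + b.val, by omega⟩

/-- The combination of two binary sequences into a four-letter sequence. -/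
def pairSeq (a b : ℕ → Fin 2) : ℕ → Fin 4 := fun n => pairSymbol (a n) (b n)

/-- The Bernoulli measure on `{0,1,2,3}^ℕ` giving weight `1/4` to each symbol. -/
def bernoulliFour : Measure (ℕ → Fin 4) :=
  Measure.infinitePi fun _ : ℕ => (PMF.uniformOfFintype (Fin 4)).toMeasure

/-- The product map of the torus. -/
def torusMap (f₁ f₂ : Circ → Circ) : Circ × Circ → Circ × Circ := fun p => (f₁ p.1, f₂ p.2)

end BowenTorus

end

/-!
Writing `stepₙ` for the distance between the left ends of two sibling atoms of generation `n + 1`,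
the map `a ↦ c - r + ∑ aₙ stepₙ` is a homeomorphism of the space of binary sequences onto the
Cantor set. The gaps along the words `a₀ … aₙ` shrink to the point coded by `a`, and a Bowen map
sends them to the gaps along the shifted words, so by continuity it sends the point coded by `a`
to the point coded by `shift a`; the itinerary map is therefore the inverse of the coding. The
parts of the Cantor set in any two atoms of the same generation are translates of each other, so
all cylinders of the same length have the same normalized Lebesgue measure: the coding carries the
fair Bernoulli measure to it.

On the circle the coding is still onto and measure preserving, and the itinerary map inverts it at
every point whose orbit avoids `-1 ∼ 1`. By invariance of the measure these points have full
measure, since a single point is null. The results on the torus follow by identifying a pair of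
binary sequences with a four-letter sequence.
-/

noncomputable section

namespace BowenTorus

section MeasureGeneral

variable {X Y : Type*} [MeasurableSpace X] [MeasurableSpace Y] {μ : Measure X} {ν : Measure Y}

lemma measurePreserving_comap {g : X → Y} (hg : MeasurableEmbedding g)
    (h : ∀ᵐ y ∂ν, y ∈ range g) : MeasurePreserving g (ν.comap g) ν :=
  ⟨hg.measurable, by rw [hg.map_comap, Measure.restrict_eq_self_of_ae_mem h]⟩

lemma exists_measurableEquiv_of_leftInverse {π : X → Y} {h : Y → X} {s : Set Y}
    (hemb : MeasurableEmbedding π) (hπ : MeasurePreserving π μ ν) (hs : range π = s)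
    (hinv : Function.LeftInverse h π) :
    ∃ H : s ≃ᵐ X, (∀ y : s, H y = h y) ∧ MeasurePreserving H (ν.comap Subtype.val) μ := by
  subst hs
  have hequiv (x : X) : (hemb.equivRange x : Y) = π x := by rw [hemb.equivRange_apply]
  refine ⟨hemb.equivRange.symm, fun y => ?_,
    MeasurePreserving.symm _ ⟨hemb.equivRange.measurable, ?_⟩⟩
  · obtain ⟨x, rfl⟩ := hemb.equivRange.surjective y
    rw [MeasurableEquiv.symm_apply_apply, hequiv, hinv]
  · rw [← hπ.map_eq, ← (MeasurableEmbedding.subtype_coe hemb.measurableSet_range).comap_map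
      (μ.map hemb.equivRange), Measure.map_map measurable_subtype_coe hemb.equivRange.measurable]
    exact congrArg (fun g => (μ.map g).comap _) (funext hequiv)

lemma ae_prod_mem_prod [SFinite μ] [SFinite ν] {s : Set X} {t : Set Y} (hs : ∀ᵐ x ∂μ, x ∈ s)
    (ht : ∀ᵐ y ∂ν, y ∈ t) : ∀ᵐ p ∂μ.prod ν, p ∈ s ×ˢ t :=
  (Measure.quasiMeasurePreserving_fst.ae hs).and (Measure.quasiMeasurePreserving_snd.ae ht)

lemma measurePreserving_cond_preimage {q : X → Y} (hq : MeasurePreserving q μ ν) {t : Set Y}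
    (ht : MeasurableSet t) : MeasurePreserving q (cond μ (q ⁻¹' t)) (cond ν t) := by
  rw [ProbabilityTheory.cond, ProbabilityTheory.cond,
    hq.measure_preimage ht.nullMeasurableSet]
  exact (hq.restrict_preimage ht).smul_measure _

lemma cond_eq_of_restrict_eq {μ' : Measure X} {s t : Set X}
    (h : μ.restrict s = μ'.restrict t) : cond μ s = cond μ' t := by
  rw [ProbabilityTheory.cond, ProbabilityTheory.cond, ← Measure.restrict_apply_univ s, h,
    Measure.restrict_apply_univ]

end MeasureGeneral

section LeftInverse

variable {X Y : Type*} {π : X → Y} {h : Y → X} {s : Set Y}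

lemma injOn_of_leftInvOn_preimage (hs : s ⊆ range π) (hinv : LeftInvOn h π (π ⁻¹' s)) :
    InjOn h s := by
  rw [← image_preimage_eq_of_subset hs]
  rintro _ ⟨x, hx, rfl⟩ _ ⟨y, hy, rfl⟩ hxy
  rw [← hinv hx, hxy, hinv hy]

lemma image_eq_preimage_of_leftInvOn_preimage (hs : s ⊆ range π)
    (hinv : LeftInvOn h π (π ⁻¹' s)) : h '' s = π ⁻¹' s := by
  conv_lhs => rw [← image_preimage_eq_of_subset hs]
  exact LeftInvOn.image_image hinv

variable [MeasurableSpace X] [MeasurableSpace Y]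

lemma measurableSet_image_of_leftInvOn_preimage (hπ : Measurable π) (hs : s ⊆ range π)
    (hinv : LeftInvOn h π (π ⁻¹' s)) (hm : MeasurableSet s) : MeasurableSet (h '' s) :=
  image_eq_preimage_of_leftInvOn_preimage hs hinv ▸ hπ hm

variable {μ : Measure X} {ν : Measure Y}

lemma measurePreserving_of_leftInvOn_preimage (hπ : MeasurePreserving π μ ν) (hh : Measurable h)
    (hinv : LeftInvOn h π (π ⁻¹' s)) (hae : ∀ᵐ y ∂ν, y ∈ s) : MeasurePreserving h ν μ := by
  refine ⟨hh, ?_⟩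
  rw [← hπ.map_eq, Measure.map_map hh hπ.measurable]
  exact (Measure.map_congr ((hπ.quasiMeasurePreserving.ae hae).mono hinv)).trans Measure.map_id

lemma ae_mem_image_of_leftInvOn_preimage (hπ : MeasurePreserving π μ ν) (hs : s ⊆ range π)
    (hinv : LeftInvOn h π (π ⁻¹' s)) (hae : ∀ᵐ y ∂ν, y ∈ s) : ∀ᵐ x ∂μ, x ∈ h '' s :=
  image_eq_preimage_of_leftInvOn_preimage hs hinv ▸ hπ.quasiMeasurePreserving.ae hae

end LeftInverse

section OrbitsIn

/-- The points of `K` whose orbit under `f` never leaves `U`. -/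
def orbitsIn {X : Type*} (f : X → X) (K U : Set X) : Set X := {x ∈ K | ∀ n, f^[n] x ∈ U}

variable {X Y : Type*} {f : X → X} {g : Y → Y} {K U : Set X} {L V : Set Y}

lemma orbitsIn_eq_inter_iInter : orbitsIn f K U = K ∩ ⋂ n, f^[n] ⁻¹' U := by
  ext
  simp [orbitsIn]

lemma mapsTo_orbitsIn (hK : MapsTo f K K) : MapsTo f (orbitsIn f K U) (orbitsIn f K U) :=
  fun _ hx => ⟨hK hx.1, fun n => hx.2 (n + 1)⟩

lemma orbitsIn_prodMap :
    orbitsIn (Prod.map f g) (K ×ˢ L) (U ×ˢ V) = orbitsIn f K U ×ˢ orbitsIn g L V := by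
  ext p
  simp only [orbitsIn, Prod.map_iterate, mem_ofPred_eq, mem_prod, Prod.map_fst, Prod.map_snd,
    forall_and]
  exact and_and_and_comm

variable [MeasurableSpace X]

lemma measurableSet_orbitsIn (hf : Measurable f) (hK : MeasurableSet K) (hU : MeasurableSet U) :
    MeasurableSet (orbitsIn f K U) := by
  rw [orbitsIn_eq_inter_iInter]
  exact hK.inter (.iInter fun n => hf.iterate n hU)

lemma ae_mem_orbitsIn {μ : Measure X} (hf : MeasurePreserving f μ μ) (hK : ∀ᵐ x ∂μ, x ∈ K)
    (hU : ∀ᵐ x ∂μ, x ∈ U) : ∀ᵐ x ∂μ, x ∈ orbitsIn f K U :=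
  hK.and (ae_all_iff.2 fun n => (hf.iterate n).quasiMeasurePreserving.ae hU)

end OrbitsIn

section SymbolSequences

lemma shift_iterate_apply {S : Type*} (a : ℕ → S) (n m : ℕ) : shift^[n] a m = a (m + n) := by
  induction n generalizing a with
  | zero => rfl
  | succ n ih => rw [Function.iterate_succ_apply, ih, shift, add_assoc]

lemma measurable_shift {S : Type*} [MeasurableSpace S] :
    Measurable (shift : (ℕ → S) → ℕ → S) :=
  measurable_pi_lambda _ fun _ => measurable_pi_apply _

lemma measurePreserving_shift {S : Type*} [MeasurableSpace S] (ρ : Measure S)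
    [IsProbabilityMeasure ρ] :
    MeasurePreserving shift (Measure.infinitePi fun _ : ℕ => ρ)
      (Measure.infinitePi fun _ : ℕ => ρ) := by
  refine ⟨measurable_shift, Measure.eq_infinitePi _ fun s t ht => ?_⟩
  have hpre : shift ⁻¹' (s : Set ℕ).pi t =
      ((s.map (addRightEmbedding 1) : Finset ℕ) : Set ℕ).pi fun n => t (n - 1) := by
    ext a
    simp [shift, Set.mem_pi]
  rw [Measure.map_apply measurable_shift (.pi s.countable_toSet fun n _ => ht n), hpre,
    Measure.infinitePi_pi _ fun n _ => ht _, Finset.prod_map]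
  rfl

lemma measurableSet_cylinder {S : Type*} [MeasurableSpace S] [DiscreteMeasurableSpace S]
    (w : ℕ → S) (n : ℕ) : MeasurableSet (PiNat.cylinder w n) := by
  rw [PiNat.cylinder_eq_pi]
  exact .pi (Finset.countable_toSet _) fun _ _ => .of_discrete

lemma isPiSystem_cylinder (S : Type*) :
    IsPiSystem {s : Set (ℕ → S) | ∃ w n, s = PiNat.cylinder w n} := by
  rintro _ ⟨x, m, rfl⟩ _ ⟨y, n, rfl⟩ ⟨z, hzx, hzy⟩
  rw [PiNat.mem_cylinder_iff_eq] at hzx hzy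
  rw [← hzx, ← hzy]
  rcases le_total m n with hmn | hmn
  · rw [inter_eq_right.2 (PiNat.cylinder_anti z hmn)]
    exact ⟨z, n, rfl⟩
  · rw [inter_eq_left.2 (PiNat.cylinder_anti z hmn)]
    exact ⟨z, m, rfl⟩

lemma ext_of_cylinder {S : Type*} [Countable S] [MeasurableSpace S] [DiscreteMeasurableSpace S]
    {ρ ρ' : Measure (ℕ → S)} [IsProbabilityMeasure ρ] [IsProbabilityMeasure ρ']
    (h : ∀ w n, ρ (PiNat.cylinder w n) = ρ' (PiNat.cylinder w n)) : ρ = ρ' := by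
  let _ : TopologicalSpace S := ⊥
  have _ : DiscreteTopology S := ⟨rfl⟩
  refine ext_of_generate_finite _ ((BorelSpace.measurable_eq (α := ℕ → S)).trans
    (PiNat.isTopologicalBasis_cylinders fun _ : ℕ => S).borel_eq_generateFrom)
    (isPiSystem_cylinder S) ?_ (by simp)
  rintro _ ⟨w, n, rfl⟩
  exact h w n

lemma sum_measure_cylinder_update {S : Type*} [Fintype S] [MeasurableSpace S]
    [DiscreteMeasurableSpace S] (ρ : Measure (ℕ → S)) (w : ℕ → S) (n : ℕ) :
    ∑ e, ρ (PiNat.cylinder (Function.update w n e) (n + 1)) = ρ (PiNat.cylinder w n) := by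
  have hdisj : Pairwise (Function.onFun Disjoint fun e =>
      PiNat.cylinder (Function.update w n e) (n + 1)) := fun e e' hne =>
    disjoint_left.2 fun a ha ha' => hne <| by
      simpa using (ha n n.lt_succ_self).symm.trans (ha' n n.lt_succ_self)
  rw [← PiNat.iUnion_cylinder_update w n,
    measure_iUnion hdisj fun _ => measurableSet_cylinder _ _, tsum_fintype]

section Uniform

variable {S : Type*} [Fintype S] [Nonempty S] [MeasurableSpace S]

variable (S) in
/-- The Bernoulli measure on one-sided sequences of symbols that gives all symbols the same
weight. -/
def uniformBernoulli : Measure (ℕ → S) :=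
  Measure.infinitePi fun _ : ℕ => (PMF.uniformOfFintype S).toMeasure

instance isProbabilityMeasure_uniformBernoulli : IsProbabilityMeasure (uniformBernoulli S) :=
  inferInstanceAs (IsProbabilityMeasure (Measure.infinitePi _))

lemma measurePreserving_shift_uniformBernoulli :
    MeasurePreserving shift (uniformBernoulli S) (uniformBernoulli S) :=
  measurePreserving_shift _

variable [DiscreteMeasurableSpace S]

lemma uniformBernoulli_cylinder (w : ℕ → S) (n : ℕ) :
    uniformBernoulli S (PiNat.cylinder w n) = (Fintype.card S : ENNReal)⁻¹ ^ n := by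
  rw [PiNat.cylinder_eq_pi, uniformBernoulli, Measure.infinitePi_pi _ fun _ _ => .of_discrete]
  simp only [PMF.toMeasure_apply_singleton _ _ MeasurableSet.of_discrete,
    PMF.uniformOfFintype_apply, Finset.prod_const, Finset.card_range]

lemma eq_uniformBernoulli_of_cylinder_eq {ρ : Measure (ℕ → S)} [IsProbabilityMeasure ρ]
    (h : ∀ w w' n, ρ (PiNat.cylinder w n) = ρ (PiNat.cylinder w' n)) :
    ρ = uniformBernoulli S := by
  refine ext_of_cylinder fun w n => ?_
  rw [uniformBernoulli_cylinder]
  induction n with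
  | zero => simp
  | succ n ih =>
    have hsplit := sum_measure_cylinder_update ρ w n
    rw [ih, Finset.sum_congr rfl fun e _ => h _ w (n + 1), Finset.sum_const, Finset.card_univ,
      nsmul_eq_mul] at hsplit
    rw [pow_succ', ← hsplit, ← mul_assoc, ENNReal.inv_mul_cancel (by simp) (by simp), one_mul]

end Uniform

section Zip

variable {S T U : Type*} [MeasurableSpace S] [MeasurableSpace T] [MeasurableSpace U]

/-- Identifies a pair of symbol sequences with one sequence over an alphabet that codes the pairs of
symbols. -/
def zipEquiv (e : S × T ≃ᵐ U) : (ℕ → S) × (ℕ → T) ≃ᵐ (ℕ → U) where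
  toEquiv := (Equiv.arrowProdEquivProdArrow ℕ (fun _ => S) fun _ => T).symm.trans
    (Equiv.piCongrRight fun _ => e.toEquiv)
  measurable_toFun := measurable_pi_lambda _ fun n => e.measurable.comp
    ((measurable_fst.eval (a := n)).prodMk (measurable_snd.eval (a := n)))
  measurable_invFun :=
    (measurable_pi_lambda _ fun n => (e.symm.measurable.comp (measurable_pi_apply n)).fst).prodMk
      (measurable_pi_lambda _ fun n => (e.symm.measurable.comp (measurable_pi_apply n)).snd)

lemma zipEquiv_preimage_cylinder (e : S × T ≃ᵐ U) (w : ℕ → U) (n : ℕ) :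
    zipEquiv e ⁻¹' PiNat.cylinder w n =
      PiNat.cylinder ((zipEquiv e).symm w).1 n ×ˢ PiNat.cylinder ((zipEquiv e).symm w).2 n := by
  ext p
  simp only [mem_preimage, PiNat.cylinder, mem_prod, mem_ofPred_eq, ← forall₂_and]
  exact forall₂_congr fun j _ => e.toEquiv.eq_symm_apply.symm.trans Prod.ext_iff

variable [Fintype S] [Nonempty S] [DiscreteMeasurableSpace S] [Fintype T] [Nonempty T]
  [DiscreteMeasurableSpace T] [Fintype U] [Nonempty U] [DiscreteMeasurableSpace U]

lemma measurePreserving_zipEquiv (e : S × T ≃ᵐ U) :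
    MeasurePreserving (zipEquiv e) ((uniformBernoulli S).prod (uniformBernoulli T))
      (uniformBernoulli U) := by
  have := Measure.isProbabilityMeasure_map
    (μ := (uniformBernoulli S).prod (uniformBernoulli T)) (zipEquiv e).measurable.aemeasurable
  refine ⟨(zipEquiv e).measurable, eq_uniformBernoulli_of_cylinder_eq fun w w' n => ?_⟩
  simp only [MeasurableEquiv.map_apply, zipEquiv_preimage_cylinder, Measure.prod_prod,
    uniformBernoulli_cylinder]

end Zip

end SymbolSequences
section Itineraries

variable {X : Type*} {f : X → X}

lemma itin_eq_iff {A : Set X} {x : X} {a : ℕ → Fin 2} :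
    itin f A x = a ↔ ∀ n, f^[n] x ∈ A ↔ a n = 1 := by
  refine funext_iff.trans (forall_congr' fun n => ?_)
  rw [itin]
  split_ifs with h
  · simp [h, eq_comm]
  · simp only [h, false_iff]
    omega

lemma measurable_itin [MeasurableSpace X] (hf : Measurable f) {A : Set X} (hA : MeasurableSet A) :
    Measurable (itin f A) := by
  classical
  exact measurable_pi_lambda _ fun n =>
    Measurable.ite (hf.iterate n hA) measurable_const measurable_const

lemma iterate_mem_itin {K : Set X} {A : Fin 2 → Set X} (hK : MapsTo f K K) (hA : K ⊆ A 0 ∪ A 1)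
    {x : X} (hx : x ∈ K) (n : ℕ) : f^[n] x ∈ A (itin f (A 1) x n) := by
  rw [itin]
  split_ifs with h
  · exact h
  · exact (hA (hK.iterate n hx)).resolve_right h

lemma itin_of_semiconj {π : (ℕ → Fin 2) → X} (hπ : Function.Semiconj π shift f) {A : Set X}
    {a : ℕ → Fin 2} (hA : ∀ n, π (shift^[n] a) ∈ A ↔ a n = 1) : itin f A (π a) = a :=
  itin_eq_iff.2 fun n => (hπ.iterate_right n a) ▸ hA n

end Itineraries

section PairSequences

/-- Identifies a pair of binary symbols with a symbol of the four-letter alphabet. -/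
def pairSymbolEquiv : Fin 2 × Fin 2 ≃ᵐ Fin 4 where
  toEquiv := Equiv.ofBijective (fun e => pairSymbol e.1 e.2) (by decide)
  measurable_toFun := measurable_of_finite _
  measurable_invFun := measurable_of_finite _

/-- Identifies a pair of binary sequences with a four-letter sequence: the uncurried `pairSeq`. -/
def pairEquiv : (ℕ → Fin 2) × (ℕ → Fin 2) ≃ᵐ (ℕ → Fin 4) := zipEquiv pairSymbolEquiv

lemma measurePreserving_pairEquiv :
    MeasurePreserving pairEquiv ((uniformBernoulli (Fin 2)).prod (uniformBernoulli (Fin 2)))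
      bernoulliFour :=
  measurePreserving_zipEquiv pairSymbolEquiv

variable {X Y : Type*} {π : (ℕ → Fin 2) → X} {ρ : (ℕ → Fin 2) → Y} {a : X → ℕ → Fin 2}
  {b : Y → ℕ → Fin 2}

/-- The point of a product coded by a four-letter sequence, given codings of the points of the
factors by binary sequences. -/
def pairCode (π : (ℕ → Fin 2) → X) (ρ : (ℕ → Fin 2) → Y) : (ℕ → Fin 4) → X × Y :=
  Prod.map π ρ ∘ pairEquiv.symm

/-- The combined itinerary of a point of a product, given binary itineraries of the points of the
factors. -/
def pairItin (a : X → ℕ → Fin 2) (b : Y → ℕ → Fin 2) (p : X × Y) : ℕ → Fin 4 :=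
  pairSeq (a p.1) (b p.2)

lemma range_pairCode : range (pairCode π ρ) = range π ×ˢ range ρ := by
  rw [pairCode, pairEquiv.symm.surjective.range_comp, range_prodMap]

lemma leftInvOn_pairItin_pairCode {s : Set X} {t : Set Y} (ha : LeftInvOn a π (π ⁻¹' s))
    (hb : LeftInvOn b ρ (ρ ⁻¹' t)) :
    LeftInvOn (pairItin a b) (pairCode π ρ) (pairCode π ρ ⁻¹' s ×ˢ t) := fun w hw =>
  (congrArg₂ pairSeq (ha hw.1) (hb hw.2)).trans (pairEquiv.apply_symm_apply w)

variable [MeasurableSpace X] [MeasurableSpace Y] {μ : Measure X} {ν : Measure Y}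

lemma measurable_pairItin (ha : Measurable a) (hb : Measurable b) : Measurable (pairItin a b) :=
  pairEquiv.measurable.comp (ha.prodMap hb)

lemma measurePreserving_pairCode [SFinite ν]
    (hπ : MeasurePreserving π (uniformBernoulli (Fin 2)) μ)
    (hρ : MeasurePreserving ρ (uniformBernoulli (Fin 2)) ν) :
    MeasurePreserving (pairCode π ρ) bernoulliFour (μ.prod ν) :=
  (hπ.prod hρ).comp (measurePreserving_pairEquiv.symm _)

end PairSequences

section Circle

variable {T t x y : ℝ} {s : Set ℝ}

lemma mem_Ioo_of_coe_ne (hx : x ∈ Icc t (t + T)) (hxt : (x : AddCircle T) ≠ t) :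
    x ∈ Ioo t (t + T) := by
  refine ⟨hx.1.lt_of_ne ?_, hx.2.lt_of_ne ?_⟩
  · rintro rfl
    exact hxt rfl
  · rintro rfl
    exact hxt (AddCircle.coe_add_period T t)

lemma isClosed_coe_image (hs : IsCompact s) :
    IsClosed (((↑) : ℝ → AddCircle T) '' s) :=
  (hs.image (AddCircle.continuous_mk' T)).isClosed

variable [hT : Fact (0 < T)]

instance nullSingletonClass_volume : NullSingletonClass (volume : Measure (AddCircle T)) where
  measure_singleton z := by
    rw [← Metric.closedBall_zero, AddCircle.volume_closedBall, mul_zero, min_eq_right hT.out.le,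
      ENNReal.ofReal_zero]

lemma coe_eq_coe_iff_of_mem_Ioo (hx : x ∈ Ioo t (t + T)) (hy : y ∈ Icc t (t + T)) :
    (x : AddCircle T) = y ↔ x = y := by
  rcases hy.2.eq_or_lt with rfl | hlt
  · rw [AddCircle.coe_add_period, AddCircle.coe_eq_coe_iff_of_mem_Ico (Ioo_subset_Ico_self hx)
      (left_mem_Ico.2 (lt_add_of_pos_right t hT.out))]
    exact iff_of_false hx.1.ne' hx.2.ne
  · exact AddCircle.coe_eq_coe_iff_of_mem_Ico (Ioo_subset_Ico_self hx) ⟨hy.1, hlt⟩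

lemma coe_mem_coe_image_iff (hs : s ⊆ Icc t (t + T)) (hx : x ∈ Ioo t (t + T)) :
    (x : AddCircle T) ∈ ((↑) : ℝ → AddCircle T) '' s ↔ x ∈ s := by
  refine ⟨?_, mem_image_of_mem _⟩
  rintro ⟨y, hy, hyx⟩
  rwa [(coe_eq_coe_iff_of_mem_Ioo hx (hs hy)).1 hyx.symm]

lemma measurePreserving_coe_cond (hc : IsCompact s) (hs : s ⊆ Icc t (t + T)) :
    MeasurePreserving ((↑) : ℝ → AddCircle T) (cond volume s)
      (cond volume (((↑) : ℝ → AddCircle T) '' s)) := by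
  have hq := AddCircle.measurePreserving_mk T t
  have hm : MeasurableSet (((↑) : ℝ → AddCircle T) '' s) := (isClosed_coe_image hc).measurableSet
  have hae : (((↑) : ℝ → AddCircle T) ⁻¹' (((↑) : ℝ → AddCircle T) '' s) ∩ Ioc t (t + T) : Set ℝ)
      =ᵐ[volume] s := by
    filter_upwards [Measure.ae_ne volume t, Measure.ae_ne volume (t + T)] with x hx hx'
    refine propext ⟨fun h => ?_, fun h => ⟨mem_image_of_mem _ h, ?_⟩⟩
    · exact (coe_mem_coe_image_iff hs ⟨h.2.1, h.2.2.lt_of_ne hx'⟩).1 h.1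
    · exact ⟨(hs h).1.lt_of_ne' hx, (hs h).2⟩
  have hcond : cond volume s = cond (volume.restrict (Ioc t (t + T)))
      (((↑) : ℝ → AddCircle T) ⁻¹' (((↑) : ℝ → AddCircle T) '' s)) := by
    refine cond_eq_of_restrict_eq ?_
    rw [Measure.restrict_restrict (hq.measurable hm), Measure.restrict_congr_set hae]
  rw [hcond]
  exact measurePreserving_cond_preimage hq hm

lemma coe_neg_one : ((-1 : ℝ) : Circ) = ((1 : ℝ) : Circ) := by
  rw [← AddCircle.coe_add_period 2 (-1)]
  norm_num

end Circle

namespace CantorData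

variable (P : CantorData)

/-- The common length of the atoms of generation `n`. -/
def len : ℕ → ℝ
  | 0 => 2 * P.r
  | n + 1 => (len n - P.gapLen n) / 2

/-- The distance between the left ends of the two atoms of generation `n + 1` inside a common atom
of generation `n`. -/
def step (n : ℕ) : ℝ := P.len n - P.len (n + 1)

/-- The point of the Cantor set that lies in all the atoms with words `a 0, …, a (n - 1)`, given as
the limit of their left ends. -/
def code (a : ℕ → Fin 2) : ℝ := P.c - P.r + ∑' n, (a n : ℝ) * P.step n

lemma gapLen_pos (n : ℕ) : 0 < P.gapLen n := by
  cases n with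
  | zero => exact mul_pos two_pos P.b_pos
  | succ n => exact div_pos (P.α_pos _ (by omega)) (by positivity)

lemma two_pow_mul_gapLen_pos (n : ℕ) : 0 < 2 ^ n * P.gapLen n :=
  mul_pos (by positivity) (P.gapLen_pos n)

lemma hasSum_two_pow_mul_gapLen :
    HasSum (fun n => 2 ^ n * P.gapLen n) (2 * P.b + ∑' n, P.α (n + 1)) := by
  have h : (fun n => 2 ^ (n + 1) * P.gapLen (n + 1)) = fun n => P.α (n + 1) := by
    funext n
    rw [gapLen]
    field_simp
  rw [← hasSum_nat_add_iff' 1, h]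
  simpa [gapLen] using P.α_summable.hasSum

lemma tsum_two_pow_mul_gapLen_lt : ∑' n, 2 ^ n * P.gapLen n < 2 * P.r := by
  rw [P.hasSum_two_pow_mul_gapLen.tsum_eq]
  linarith [P.α_sum]

lemma two_pow_mul_len (n : ℕ) :
    2 ^ n * P.len n = 2 * P.r - ∑ j ∈ Finset.range n, 2 ^ j * P.gapLen j := by
  induction n with
  | zero => simp [len]
  | succ n ih =>
    rw [Finset.sum_range_succ, len, ← sub_sub, ← ih]
    ring

lemma len_pos (n : ℕ) : 0 < P.len n := by
  have hle : ∑ j ∈ Finset.range n, 2 ^ j * P.gapLen j ≤ ∑' j, 2 ^ j * P.gapLen j :=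
    P.hasSum_two_pow_mul_gapLen.summable.sum_le_tsum _ fun j _ => (P.two_pow_mul_gapLen_pos j).le
  have hpos : 0 < 2 ^ n * P.len n := by
    rw [two_pow_mul_len]
    linarith [P.tsum_two_pow_mul_gapLen_lt]
  exact pos_of_mul_pos_right hpos (by positivity)

lemma step_eq (n : ℕ) : P.step n = P.len (n + 1) + P.gapLen n := by
  simp only [step, len]
  ring

lemma step_pos (n : ℕ) : 0 < P.step n := by
  rw [step_eq]
  exact add_pos (P.len_pos (n + 1)) (P.gapLen_pos n)

lemma len_le (n : ℕ) : P.len n ≤ 2 * P.r * (1 / 2) ^ n := by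
  induction n with
  | zero => simp [len]
  | succ n ih =>
    rw [pow_succ, len]
    linarith [P.gapLen_pos n]

lemma tendsto_len : Tendsto P.len atTop (𝓝 0) := by
  have h : Tendsto (fun n : ℕ => 2 * P.r * (1 / 2 : ℝ) ^ n) atTop (𝓝 (2 * P.r * 0)) :=
    (tendsto_pow_atTop_nhds_zero_of_lt_one (by norm_num) (by norm_num)).const_mul _
  rw [mul_zero] at h
  exact squeeze_zero (fun n => (P.len_pos n).le) P.len_le h

lemma sum_range_step_add (n m : ℕ) :
    ∑ j ∈ Finset.range m, P.step (j + n) = P.len n - P.len (m + n) := by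
  induction m with
  | zero => simp
  | succ m ih =>
    rw [Finset.sum_range_succ, ih, step, add_right_comm]
    ring

lemma hasSum_step_add (n : ℕ) : HasSum (fun j => P.step (j + n)) (P.len n) := by
  rw [hasSum_iff_tendsto_nat_of_nonneg fun j => (P.step_pos _).le]
  simp only [sum_range_step_add]
  simpa using ((tendsto_add_atTop_iff_nat n).2 P.tendsto_len).const_sub (P.len n)

lemma mul_step_nonneg (e : Fin 2) (n : ℕ) : 0 ≤ (e : ℝ) * P.step n :=
  mul_nonneg (Nat.cast_nonneg _) (P.step_pos n).le

lemma mul_step_le (e : Fin 2) (n : ℕ) : (e : ℝ) * P.step n ≤ P.step n :=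
  mul_le_of_le_one_left (P.step_pos n).le (mod_cast e.is_le)

lemma summable_mul_step_add (a : ℕ → Fin 2) (n : ℕ) :
    Summable fun j => (a (j + n) : ℝ) * P.step (j + n) :=
  .of_nonneg_of_le (fun _ => P.mul_step_nonneg _ _) (fun _ => P.mul_step_le _ _)
    (P.hasSum_step_add n).summable

lemma ends_snd (a : ℕ → Fin 2) (n : ℕ) : (P.ends a n).2 = (P.ends a n).1 + P.len n := by
  induction n with
  | zero =>
    simp only [ends, len]
    ring
  | succ n ih =>
    rw [ends, len]
    split_ifs <;> simp only [ih] <;> ring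

lemma gapLeft_eq (a : ℕ → Fin 2) (n : ℕ) : P.gapLeft a n = (P.ends a n).1 + P.len (n + 1) := by
  rw [gapLeft, ends_snd, len]
  ring

lemma gapRight_eq (a : ℕ → Fin 2) (n : ℕ) : P.gapRight a n = (P.ends a n).1 + P.step n := by
  rw [gapRight, ends_snd, step, len]
  ring

lemma gapLeft_lt_gapRight (a : ℕ → Fin 2) (n : ℕ) : P.gapLeft a n < P.gapRight a n := by
  rw [gapLeft_eq, gapRight_eq, step_eq]
  linarith [P.gapLen_pos n]

lemma ends_fst_succ (a : ℕ → Fin 2) (n : ℕ) :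
    (P.ends a (n + 1)).1 = (P.ends a n).1 + a n * P.step n := by
  rw [ends]
  split_ifs with h
  · simp [h]
  · rw [Fin.eq_one_of_ne_zero _ h, ← gapRight, gapRight_eq]
    simp

lemma ends_fst (a : ℕ → Fin 2) (n : ℕ) :
    (P.ends a n).1 = P.c - P.r + ∑ j ∈ Finset.range n, (a j : ℝ) * P.step j := by
  induction n with
  | zero => simp [ends]
  | succ n ih => rw [ends_fst_succ, ih, Finset.sum_range_succ, add_assoc]

lemma code_eq (a : ℕ → Fin 2) (n : ℕ) :
    P.code a = (P.ends a n).1 + ∑' j, (a (j + n) : ℝ) * P.step (j + n) := by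
  have h : Summable fun j => (a j : ℝ) * P.step j := P.summable_mul_step_add a 0
  rw [code, ends_fst, ← h.sum_add_tsum_nat_add n, add_assoc]

lemma ends_congr {a a' : ℕ → Fin 2} {n : ℕ} (h : ∀ j < n, a j = a' j) :
    P.ends a n = P.ends a' n := by
  induction n with
  | zero => rfl
  | succ n ih => rw [ends, ends, ih fun j hj => h j (hj.trans n.lt_succ_self), h n n.lt_succ_self]

lemma atom_congr {a a' : ℕ → Fin 2} {n : ℕ} (h : ∀ j < n, a j = a' j) :
    P.atom a n = P.atom a' n := by
  rw [atom, atom, P.ends_congr h]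

lemma gap_congr {a a' : ℕ → Fin 2} {n : ℕ} (h : ∀ j < n, a j = a' j) :
    P.gap a n = P.gap a' n := by
  rw [gap, gap, gapLeft, gapLeft, gapRight, gapRight, P.ends_congr h]

lemma code_mem_atom (a : ℕ → Fin 2) (n : ℕ) : P.code a ∈ P.atom a n := by
  rw [atom, mem_Icc, ends_snd, P.code_eq a n]
  constructor
  · exact le_add_of_nonneg_right (tsum_nonneg fun j => P.mul_step_nonneg _ _)
  · gcongr
    rw [← (P.hasSum_step_add n).tsum_eq]
    exact (P.summable_mul_step_add a n).tsum_le_tsum (fun _ => P.mul_step_le _ _)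
      (P.hasSum_step_add n).summable

lemma atom_succ_of_eq_zero {a : ℕ → Fin 2} {n : ℕ} (h : a n = 0) :
    P.atom a (n + 1) = Icc (P.ends a n).1 (P.gapLeft a n) := by
  rw [atom, ends, if_pos h, gapLeft]

lemma atom_succ_of_ne_zero {a : ℕ → Fin 2} {n : ℕ} (h : a n ≠ 0) :
    P.atom a (n + 1) = Icc (P.gapRight a n) (P.ends a n).2 := by
  rw [atom, ends, if_neg h, gapRight]

lemma gap_subset_atom (a : ℕ → Fin 2) (n : ℕ) : P.gap a n ⊆ P.atom a n := by
  refine Ioo_subset_Icc_self.trans (Icc_subset_Icc ?_ ?_)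
  · rw [gapLeft_eq]
    linarith [P.len_pos (n + 1)]
  · rw [gapRight_eq, ends_snd, step]
    linarith [P.len_pos (n + 1)]

lemma atom_succ_subset (a : ℕ → Fin 2) (n : ℕ) : P.atom a (n + 1) ⊆ P.atom a n := by
  refine Icc_subset_Icc ?_ ?_
  · rw [ends_fst_succ]
    linarith [P.mul_step_nonneg (a n) n]
  · rw [ends_snd, ends_snd, ends_fst_succ]
    have hstep : P.step n = P.len n - P.len (n + 1) := rfl
    linarith [P.mul_step_le (a n) n]

lemma atom_antitone (a : ℕ → Fin 2) : Antitone (P.atom a) :=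
  antitone_nat_of_succ_le (P.atom_succ_subset a)

lemma disjoint_gap_atom_succ (a : ℕ → Fin 2) (n : ℕ) :
    Disjoint (P.gap a n) (P.atom a (n + 1)) := by
  refine disjoint_left.2 fun x hgap hatom => ?_
  by_cases h : a n = 0
  · rw [P.atom_succ_of_eq_zero h] at hatom
    exact hatom.2.not_gt hgap.1
  · rw [P.atom_succ_of_ne_zero h] at hatom
    exact hatom.1.not_gt hgap.2

lemma disjoint_atom_succ {a a' : ℕ → Fin 2} {n : ℕ} (h : ∀ j < n, a j = a' j)
    (hn : a n ≠ a' n) : Disjoint (P.atom a (n + 1)) (P.atom a' (n + 1)) := by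
  wlog h0 : a n = 0 generalizing a a'
  · exact (this (fun j hj => (h j hj).symm) hn.symm (by omega)).symm
  have hgap : P.gapLeft a n < P.gapRight a' n := by
    rw [gapRight, ← P.ends_congr h, ← gapRight]
    exact P.gapLeft_lt_gapRight a n
  rw [P.atom_succ_of_eq_zero h0, P.atom_succ_of_ne_zero (h0 ▸ hn.symm)]
  exact disjoint_left.2 fun x hx hx' => (hx.2.trans_lt hgap).not_ge hx'.1

lemma code_mem_atom_iff {a a' : ℕ → Fin 2} {n : ℕ} :
    P.code a ∈ P.atom a' n ↔ ∀ j < n, a j = a' j := by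
  refine ⟨fun h => ?_, fun h => P.atom_congr h ▸ P.code_mem_atom a n⟩
  induction n with
  | zero => simp
  | succ n ih =>
    have hlt := ih (P.atom_succ_subset a' n h)
    have heq : a n = a' n := by
      by_contra hn
      exact disjoint_left.1 (P.disjoint_atom_succ hlt hn) (P.code_mem_atom a (n + 1)) h
    exact Nat.forall_lt_succ_right.2 ⟨hlt, heq⟩

lemma code_notMem_gap (a a' : ℕ → Fin 2) (n : ℕ) : P.code a ∉ P.gap a' n := by
  intro h
  have heq := P.code_mem_atom_iff.1 (P.gap_subset_atom a' n h)
  rw [← P.gap_congr heq] at h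
  exact disjoint_left.1 (P.disjoint_gap_atom_succ a n) h (P.code_mem_atom a (n + 1))

lemma code_injective : Function.Injective P.code := fun _ a' h => funext fun n =>
  P.code_mem_atom_iff.1 (h ▸ P.code_mem_atom a' (n + 1)) n n.lt_succ_self

lemma continuous_code : Continuous P.code := by
  refine continuous_const.add (continuous_tsum (u := P.step) (fun n => ?_)
    (P.hasSum_step_add 0).summable fun n a => ?_)
  · exact (continuous_of_discreteTopology (f := fun e : Fin 2 => (e : ℝ) * P.step n)).comp
      (continuous_apply n)
  · rw [Real.norm_of_nonneg (P.mul_step_nonneg _ _)]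
    exact P.mul_step_le _ _

lemma isClosedEmbedding_code : IsClosedEmbedding P.code :=
  P.continuous_code.isClosedEmbedding P.code_injective

lemma dist_code_le {a : ℕ → Fin 2} {n : ℕ} {x : ℝ} (h : x ∈ P.atom a n) :
    dist x (P.code a) ≤ P.len n := by
  have := Real.dist_le_of_mem_Icc h (P.code_mem_atom a n)
  rwa [ends_snd, add_sub_cancel_left] at this

lemma tendsto_code {a : ℕ → Fin 2} {x : ℕ → ℝ} (h : ∀ n, x n ∈ P.atom a n) :
    Tendsto x atTop (𝓝 (P.code a)) :=
  tendsto_iff_dist_tendsto_zero.2 <| squeeze_zero (fun _ => dist_nonneg)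
    (fun n => P.dist_code_le (h n)) P.tendsto_len

lemma range_code : range P.code = P.cantor := by
  refine Subset.antisymm ?_ fun x hx => ?_
  · rintro _ ⟨a, rfl⟩
    exact mem_iInter.2 fun n => mem_iUnion.2 ⟨a, P.code_mem_atom a _⟩
  · rw [← P.isClosedEmbedding_code.isClosed_range.closure_eq, Metric.mem_closure_iff]
    intro ε hε
    obtain ⟨n, hn⟩ := (((tendsto_add_atTop_iff_nat 1).2 P.tendsto_len).eventually
      (gt_mem_nhds hε)).exists
    obtain ⟨a, ha⟩ := mem_iUnion.1 (mem_iInter.1 hx n)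
    exact ⟨_, mem_range_self a, (P.dist_code_le ha).trans_lt hn⟩

lemma code_mem_cantor (a : ℕ → Fin 2) : P.code a ∈ P.cantor :=
  P.range_code ▸ mem_range_self a

lemma isCompact_cantor : IsCompact P.cantor :=
  P.range_code ▸ isCompact_range P.continuous_code

lemma cantor_subset_Icc : P.cantor ⊆ Icc (P.c - P.r) (P.c + P.r) := by
  rw [← range_code]
  rintro _ ⟨a, rfl⟩
  exact P.code_mem_atom a 0

lemma atom_one (a : ℕ → Fin 2) : P.atom a 1 = P.piece (a 0) := by
  by_cases h : a 0 = 0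
  · rw [P.atom_succ_of_eq_zero h, piece, if_pos h]
    congr 1
    simp only [gapLeft, ends, gapLen]
    ring
  · rw [P.atom_succ_of_ne_zero h, piece, if_neg h]
    congr 1
    simp only [gapRight, ends, gapLen]
    ring

lemma piece_subset_Icc (e : Fin 2) : P.piece e ⊆ Icc (P.c - P.r) (P.c + P.r) := by
  rw [← P.atom_one fun _ => e]
  exact P.atom_succ_subset _ 0

lemma isCompact_piece (e : Fin 2) : IsCompact (P.piece e) := by
  rw [← P.atom_one fun _ => e]
  exact isCompact_Icc

lemma code_mem_piece_iff {a : ℕ → Fin 2} {e : Fin 2} : P.code a ∈ P.piece e ↔ a 0 = e := by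
  rw [← P.atom_one fun _ => e, code_mem_atom_iff]
  simp

lemma atom_one_subset_piece (a : ℕ → Fin 2) : P.atom a 1 ⊆ P.piece 0 ∪ P.piece 1 := by
  rw [atom_one]
  rcases Fin.exists_fin_two.1 ⟨a 0, rfl⟩ with h | h <;> rw [← h]
  exacts [subset_union_left, subset_union_right]

lemma cantor_subset_piece : P.cantor ⊆ P.piece 0 ∪ P.piece 1 := by
  rw [← range_code]
  rintro _ ⟨a, rfl⟩
  exact P.atom_one_subset_piece a (P.code_mem_atom a 1)

lemma exists_mem_atom_update {a : ℕ → Fin 2} {n : ℕ} {x : ℝ} (h : x ∈ P.atom a n)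
    (hgap : x ∉ P.gap a n) : ∃ e, x ∈ P.atom (Function.update a n e) (n + 1) := by
  have hends (e : Fin 2) : P.ends (Function.update a n e) n = P.ends a n :=
    P.ends_congr fun j hj => Function.update_of_ne hj.ne _ _
  rcases not_and_or.1 hgap with hleft | hright
  · refine ⟨0, ?_⟩
    rw [P.atom_succ_of_eq_zero (Function.update_self ..), gapLeft, hends, ← gapLeft]
    exact ⟨h.1, not_lt.1 hleft⟩
  · refine ⟨1, ?_⟩
    rw [P.atom_succ_of_ne_zero (by simp), gapRight, hends, ← gapRight]
    exact ⟨not_lt.1 hright, h.2⟩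

lemma Icc_subset_cantor_union_gap :
    Icc (P.c - P.r) (P.c + P.r) ⊆ P.cantor ∪ ⋃ n, ⋃ a, P.gap a n := by
  intro x hx
  by_contra! hx'
  obtain ⟨hcantor, hgap⟩ := not_or.1 hx'
  simp only [mem_iUnion, not_exists] at hgap
  have h (n : ℕ) : ∃ a, x ∈ P.atom a n := by
    induction n with
    | zero => exact ⟨0, hx⟩
    | succ n ih =>
      obtain ⟨a, ha⟩ := ih
      obtain ⟨e, he⟩ := P.exists_mem_atom_update ha (hgap n a)
      exact ⟨_, he⟩
  exact hcantor (mem_iInter.2 fun n => mem_iUnion.2 (h _))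

lemma volume_gap (a : ℕ → Fin 2) (n : ℕ) : volume (P.gap a n) = ENNReal.ofReal (P.gapLen n) := by
  rw [gap, Real.volume_Ioo, gapLeft, gapRight]
  congr 1
  ring

lemma volume_iUnion_gap_le (n : ℕ) :
    volume (⋃ a, P.gap a n) ≤ ENNReal.ofReal (2 ^ n * P.gapLen n) := by
  obtain ⟨extend, hextend⟩ : ∃ extend : (Fin n → Fin 2) → ℕ → Fin 2,
      ∀ a : ℕ → Fin 2, ∀ j < n, a j = extend (fun j => a j) j :=
    ⟨fun w j => if h : j < n then w ⟨j, h⟩ else 0, fun a j hj => by simp [hj]⟩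
  have hwords : ⋃ a, P.gap a n ⊆ ⋃ w, P.gap (extend w) n := iUnion_subset fun a =>
    P.gap_congr (hextend a) ▸ subset_iUnion (fun w => P.gap (extend w) n) fun j => a j
  calc volume (⋃ a, P.gap a n) ≤ ∑ w, volume (P.gap (extend w) n) :=
        (measure_mono hwords).trans (measure_iUnion_fintype_le _ _)
    _ = ENNReal.ofReal (2 ^ n * P.gapLen n) := by
        simp [volume_gap, ENNReal.ofReal_mul]

lemma volume_iUnion_iUnion_gap_lt :
    volume (⋃ n, ⋃ a, P.gap a n) < volume (Icc (P.c - P.r) (P.c + P.r)) := by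
  have hr : 0 < 2 * P.r := mul_pos two_pos (P.b_pos.trans P.b_lt)
  calc volume (⋃ n, ⋃ a, P.gap a n) ≤ ∑' n, ENNReal.ofReal (2 ^ n * P.gapLen n) :=
        (measure_iUnion_le _).trans (ENNReal.tsum_le_tsum P.volume_iUnion_gap_le)
    _ = ENNReal.ofReal (∑' n, 2 ^ n * P.gapLen n) :=
        (ENNReal.ofReal_tsum_of_nonneg (fun n => (P.two_pow_mul_gapLen_pos n).le)
          P.hasSum_two_pow_mul_gapLen.summable).symm
    _ < ENNReal.ofReal (2 * P.r) :=
        (ENNReal.ofReal_lt_ofReal_iff hr).2 P.tsum_two_pow_mul_gapLen_lt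
    _ = volume (Icc (P.c - P.r) (P.c + P.r)) := by
        rw [Real.volume_Icc]
        congr 1
        ring

lemma volume_cantor_ne_zero : volume P.cantor ≠ 0 := fun h =>
  P.volume_iUnion_iUnion_gap_lt.not_ge <|
    (measure_mono P.Icc_subset_cantor_union_gap).trans <|
      (measure_union_le _ _).trans_eq (by rw [h, zero_add])

instance isProbabilityMeasure_cond_cantor : IsProbabilityMeasure (cond volume P.cantor) :=
  cond_isProbabilityMeasure_of_finite P.volume_cantor_ne_zero P.isCompact_cantor.measure_ne_top

lemma volume_image_code_cylinder (w w' : ℕ → Fin 2) (n : ℕ) :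
    volume (P.code '' PiNat.cylinder w n) = volume (P.code '' PiNat.cylinder w' n) := by
  have hsub (w w' : ℕ → Fin 2) : P.code '' PiNat.cylinder w n ⊆
      (fun x => (P.ends w' n).1 - (P.ends w n).1 + x) ⁻¹' (P.code '' PiNat.cylinder w' n) := by
    rintro _ ⟨a, ha, rfl⟩
    -- Replacing the first `n` symbols translates the coded point by the difference of the left ends
    -- of the two atoms of generation `n`.
    let a' : ℕ → Fin 2 := fun j => if j < n then w' j else a j
    have ha' : a' ∈ PiNat.cylinder w' n := fun j hj => if_pos hj
    refine ⟨a', ha', ?_⟩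
    rw [P.code_eq a n, P.code_eq a' n, P.ends_congr ha, P.ends_congr ha']
    simp [a', ← add_assoc]
  have hle (w w' : ℕ → Fin 2) : volume (P.code '' PiNat.cylinder w n) ≤
      volume (P.code '' PiNat.cylinder w' n) :=
    (measure_mono (hsub w w')).trans_eq (measure_preimage_add _ _ _)
  exact le_antisymm (hle w w') (hle w' w)

lemma measurePreserving_code :
    MeasurePreserving P.code (uniformBernoulli (Fin 2)) (cond volume P.cantor) := by
  have hemb := P.isClosedEmbedding_code.measurableEmbedding
  have hK := P.isCompact_cantor.measurableSet
  have hae : ∀ᵐ x ∂cond volume P.cantor, x ∈ range P.code :=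
    (ae_cond_mem hK).mono fun _ hx => P.range_code.ge hx
  have := hemb.isProbabilityMeasure_comap hae
  have hcylinder (w : ℕ → Fin 2) (n : ℕ) :
      (cond volume P.cantor).comap P.code (PiNat.cylinder w n) =
        (volume P.cantor)⁻¹ * volume (P.code '' PiNat.cylinder w n) := by
    rw [hemb.comap_apply, cond_apply hK,
      inter_eq_right.2 ((image_subset_range _ _).trans P.range_code.subset)]
  rw [← eq_uniformBernoulli_of_cylinder_eq fun w w' n => by
    rw [hcylinder, hcylinder, P.volume_image_code_cylinder w w']]
  exact measurePreserving_comap hemb hae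

/-- The point of the Cantor set on the circle coded by `a`. -/
def codeCirc (a : ℕ → Fin 2) : Circ := (P.code a : Circ)

/-- The atoms of generation `1` on the circle. -/
def pieceCirc (e : Fin 2) : Set Circ := (fun x : ℝ => (x : Circ)) '' P.piece e

lemma continuous_codeCirc : Continuous P.codeCirc :=
  (AddCircle.continuous_mk' 2).comp P.continuous_code

lemma range_codeCirc : range P.codeCirc = P.cantorCirc := by
  rw [cantorCirc, ← P.range_code, ← range_comp]
  rfl

lemma measurableSet_cantorCirc : MeasurableSet P.cantorCirc :=
  (isClosed_coe_image P.isCompact_cantor).measurableSet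

lemma measurableSet_pieceCirc (e : Fin 2) : MeasurableSet (P.pieceCirc e) :=
  (isClosed_coe_image (P.isCompact_piece e)).measurableSet

lemma cantorCirc_subset_pieceCirc : P.cantorCirc ⊆ P.pieceCirc 0 ∪ P.pieceCirc 1 := by
  rw [pieceCirc, pieceCirc, ← image_union]
  exact image_mono P.cantor_subset_piece

lemma codeCirc_mem_pieceCirc_iff {t : ℝ}
    (hP : Icc (P.c - P.r) (P.c + P.r) ⊆ Icc t (t + 2)) {a : ℕ → Fin 2} {e : Fin 2}
    (ha : P.codeCirc a ≠ (t : Circ)) : P.codeCirc a ∈ P.pieceCirc e ↔ a 0 = e := by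
  have hmem := mem_Ioo_of_coe_ne (hP (P.code_mem_atom a 0)) ha
  rw [codeCirc, pieceCirc, coe_mem_coe_image_iff ((P.piece_subset_Icc e).trans hP) hmem,
    code_mem_piece_iff]

lemma measurePreserving_codeCirc {t : ℝ} (hP : Icc (P.c - P.r) (P.c + P.r) ⊆ Icc t (t + 2)) :
    MeasurePreserving P.codeCirc (uniformBernoulli (Fin 2)) (cond volume P.cantorCirc) :=
  (measurePreserving_coe_cond P.isCompact_cantor (P.cantor_subset_Icc.trans hP)).comp
    P.measurePreserving_code

/-- The points of the Cantor set on the circle whose orbit under `f` avoids the point `-1 ∼ 1`, so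
that they have only one itinerary. -/
def regular (f : Circ → Circ) : Set Circ := orbitsIn f P.cantorCirc {((1 : ℝ) : Circ)}ᶜ

lemma measurableSet_regular {f : Circ → Circ} (hf : Measurable f) :
    MeasurableSet (P.regular f) :=
  measurableSet_orbitsIn hf P.measurableSet_cantorCirc (measurableSet_singleton _).compl

end CantorData

/-- The part of Bowen's conditions that determines the dynamics on the Cantor set: `G` is continuous
on the atoms of generation `1` and maps each gap into the gap with the shifted word. -/
structure IsGapMap (P : CantorData) (G : ℝ → ℝ) : Prop where
  cont : ContinuousOn G (P.piece 0 ∪ P.piece 1)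
  mapsTo_gap : ∀ a n, MapsTo G (P.gap a (n + 1)) (P.gap (shift a) n)

namespace IsGapMap

variable {P : CantorData} {G : ℝ → ℝ}

lemma semiconj_code (hG : IsGapMap P G) : Function.Semiconj P.code shift G := fun a => by
  -- Points of the gaps along `a` converge to the point coded by `a`, and their images lie in the
  -- gaps along `shift a`.
  choose y hy using fun n => nonempty_Ioo.2 (P.gapLeft_lt_gapRight a (n + 1))
  have hatom (n : ℕ) : y n ∈ P.atom a (n + 1) := P.gap_subset_atom a (n + 1) (hy n)
  have hpiece (n : ℕ) : y n ∈ P.piece 0 ∪ P.piece 1 :=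
    P.atom_one_subset_piece a (P.atom_antitone a (Nat.le_add_left 1 n) (hatom n))
  have hlim : Tendsto y atTop (𝓝 (P.code a)) :=
    P.tendsto_code fun n => P.atom_succ_subset a n (hatom n)
  have himage : Tendsto (G ∘ y) atTop (𝓝 (P.code (shift a))) :=
    P.tendsto_code fun n => P.gap_subset_atom _ n (hG.mapsTo_gap a n (hy n))
  have hcont := hG.cont (P.code a) (P.cantor_subset_piece (P.code_mem_cantor a))
  exact tendsto_nhds_unique himage
    (hcont.tendsto.comp (tendsto_nhdsWithin_iff.2 ⟨hlim, .of_forall hpiece⟩))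

lemma mapsTo_cantor (hG : IsGapMap P G) : MapsTo G P.cantor P.cantor :=
  P.range_code ▸ hG.semiconj_code.mapsTo_range

lemma iterate_mem_piece (hG : IsGapMap P G) {x : ℝ} (hx : x ∈ P.cantor) (n : ℕ) :
    G^[n] x ∈ P.piece (itin G (P.piece 1) x n) :=
  iterate_mem_itin hG.mapsTo_cantor P.cantor_subset_piece hx n

lemma itin_code (hG : IsGapMap P G) : Function.LeftInverse (itin G (P.piece 1)) P.code := fun a =>
  itin_of_semiconj hG.semiconj_code fun n => by
    rw [P.code_mem_piece_iff, shift_iterate_apply, zero_add]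

lemma exists_measurableEquiv_prod {Q : CantorData} {H : ℝ → ℝ} (hG : IsGapMap P G)
    (hH : IsGapMap Q H) :
    ∃ e : (P.cantor ×ˢ Q.cantor : Set (ℝ × ℝ)) ≃ᵐ (ℕ → Fin 4),
      (∀ p : (P.cantor ×ˢ Q.cantor : Set (ℝ × ℝ)),
        e p = pairItin (itin G (P.piece 1)) (itin H (Q.piece 1)) p) ∧
      MeasurePreserving e (((cond volume P.cantor).prod (cond volume Q.cantor)).comap Subtype.val)
        bernoulliFour := by
  have hemb : MeasurableEmbedding (pairCode P.code Q.code) :=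
    (P.isClosedEmbedding_code.prodMap Q.isClosedEmbedding_code).measurableEmbedding.comp
      pairEquiv.symm.measurableEmbedding
  refine exists_measurableEquiv_of_leftInverse hemb
    (measurePreserving_pairCode P.measurePreserving_code Q.measurePreserving_code)
    (by rw [range_pairCode, P.range_code, Q.range_code]) fun w => ?_
  exact leftInvOn_pairItin_pairCode (s := univ) (t := univ) (fun a _ => hG.itin_code a)
    (fun a _ => hH.itin_code a) (mem_prod.2 ⟨mem_univ _, mem_univ _⟩)

end IsGapMap

/-- The Cantor set of `P` is constructed inside `[-1, 1]`, and on it the circle map `f` is induced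
by the gap map `G`. The right end `1` is written `-1 + 2`, the form in which fundamental intervals
of `AddCircle 2` appear. -/
structure IsCircleModel (P : CantorData) (G : ℝ → ℝ) (f : Circ → Circ) : Prop where
  measurable : Measurable f
  Icc_subset : Icc (P.c - P.r) (P.c + P.r) ⊆ Icc (-1) (-1 + 2)
  gapMap : IsGapMap P G
  coe_eq : ∀ x ∈ P.cantor, f (x : Circ) = (G x : Circ)

namespace IsCircleModel

variable {P : CantorData} {G : ℝ → ℝ} {f : Circ → Circ}

lemma measurePreserving_codeCirc (hf : IsCircleModel P G f) :
    MeasurePreserving P.codeCirc (uniformBernoulli (Fin 2)) (cond volume P.cantorCirc) :=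
  P.measurePreserving_codeCirc hf.Icc_subset

lemma isProbabilityMeasure (hf : IsCircleModel P G f) :
    IsProbabilityMeasure (cond volume P.cantorCirc) :=
  hf.measurePreserving_codeCirc.map_eq ▸
    Measure.isProbabilityMeasure_map P.continuous_codeCirc.aemeasurable

lemma semiconj_codeCirc (hf : IsCircleModel P G f) : Function.Semiconj P.codeCirc shift f :=
  fun a => (congrArg _ (hf.gapMap.semiconj_code a)).trans
    (hf.coe_eq _ (P.code_mem_cantor a)).symm

lemma mapsTo_cantorCirc (hf : IsCircleModel P G f) : MapsTo f P.cantorCirc P.cantorCirc :=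
  P.range_codeCirc ▸ hf.semiconj_codeCirc.mapsTo_range

lemma measurePreserving (hf : IsCircleModel P G f) :
    MeasurePreserving f (cond volume P.cantorCirc) (cond volume P.cantorCirc) :=
  hf.measurePreserving_codeCirc.of_semiconj measurePreserving_shift_uniformBernoulli
    hf.semiconj_codeCirc hf.measurable

lemma measurable_itin (hf : IsCircleModel P G f) : Measurable (itin f (P.pieceCirc 1)) :=
  BowenTorus.measurable_itin hf.measurable (P.measurableSet_pieceCirc 1)

lemma iterate_mem_pieceCirc (hf : IsCircleModel P G f) {x : Circ} (hx : x ∈ P.cantorCirc) (n : ℕ) :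
    f^[n] x ∈ P.pieceCirc (itin f (P.pieceCirc 1) x n) :=
  iterate_mem_itin hf.mapsTo_cantorCirc P.cantorCirc_subset_pieceCirc hx n

lemma ae_mem_regular (hf : IsCircleModel P G f) :
    ∀ᵐ x ∂cond volume P.cantorCirc, x ∈ P.regular f :=
  ae_mem_orbitsIn hf.measurePreserving (ae_cond_mem P.measurableSet_cantorCirc)
    (cond_absolutelyContinuous.ae_le (Measure.ae_ne volume _))

lemma leftInvOn_itin_codeCirc (hf : IsCircleModel P G f) :
    LeftInvOn (itin f (P.pieceCirc 1)) P.codeCirc (P.codeCirc ⁻¹' P.regular f) := fun a ha =>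
  itin_of_semiconj hf.semiconj_codeCirc fun n => by
    have hne : P.codeCirc (shift^[n] a) ≠ ((-1 : ℝ) : Circ) := by
      rw [coe_neg_one, hf.semiconj_codeCirc.iterate_right n a]
      exact ha.2 n
    rw [P.codeCirc_mem_pieceCirc_iff hf.Icc_subset hne, shift_iterate_apply, zero_add]

end IsCircleModel

section Torus

variable {P Q : CantorData} {G₁ G₂ : ℝ → ℝ} {f₁ f₂ : Circ → Circ}

/-- The points of the product Cantor set on the torus whose orbit never has a coordinate at the
point `-1 ∼ 1`. -/
def regularTorus (P Q : CantorData) (f₁ f₂ : Circ → Circ) : Set (Circ × Circ) :=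
  orbitsIn (torusMap f₁ f₂) (P.cantorCirc ×ˢ Q.cantorCirc)
    ({((1 : ℝ) : Circ)}ᶜ ×ˢ {((1 : ℝ) : Circ)}ᶜ)

lemma regularTorus_eq_prod : regularTorus P Q f₁ f₂ = P.regular f₁ ×ˢ Q.regular f₂ :=
  orbitsIn_prodMap

lemma measurableSet_regularTorus (hf₁ : Measurable f₁) (hf₂ : Measurable f₂) :
    MeasurableSet (regularTorus P Q f₁ f₂) :=
  regularTorus_eq_prod ▸ (P.measurableSet_regular hf₁).prod (Q.measurableSet_regular hf₂)

lemma regularTorus_subset_range_pairCode :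
    regularTorus P Q f₁ f₂ ⊆ range (pairCode P.codeCirc Q.codeCirc) := by
  rw [range_pairCode, P.range_codeCirc, Q.range_codeCirc]
  exact fun p hp => hp.1

lemma IsCircleModel.ae_mem_regularTorus (h₁ : IsCircleModel P G₁ f₁)
    (h₂ : IsCircleModel Q G₂ f₂) :
    ∀ᵐ p ∂(cond volume P.cantorCirc).prod (cond volume Q.cantorCirc),
      p ∈ regularTorus P Q f₁ f₂ :=
  regularTorus_eq_prod ▸ ae_prod_mem_prod h₁.ae_mem_regular h₂.ae_mem_regular

lemma IsCircleModel.leftInvOn_pairItin_pairCode (h₁ : IsCircleModel P G₁ f₁)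
    (h₂ : IsCircleModel Q G₂ f₂) :
    LeftInvOn (pairItin (itin f₁ (P.pieceCirc 1)) (itin f₂ (Q.pieceCirc 1)))
      (pairCode P.codeCirc Q.codeCirc)
      (pairCode P.codeCirc Q.codeCirc ⁻¹' regularTorus P Q f₁ f₂) :=
  regularTorus_eq_prod ▸ BowenTorus.leftInvOn_pairItin_pairCode h₁.leftInvOn_itin_codeCirc
    h₂.leftInvOn_itin_codeCirc

end Torus

lemma IsBowenMap.isGapMap {P : CantorData} {G : ℝ → ℝ} (hG : IsBowenMap P G) : IsGapMap P G :=
  ⟨hG.cont, fun a n => mapsTo_iff_image_subset.2 (hG.surj a n).subset⟩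

namespace BowenCircleMap

variable {k : ℕ} [NeZero k] (Φ : BowenCircleMap k)

lemma continuous_f : Continuous Φ.f := by
  refine (QuotientAddGroup.isQuotientMap_mk
    (N := AddSubgroup.zmultiples (2 : ℝ))).continuous_iff.2 ?_
  have hlift : Φ.f ∘ QuotientAddGroup.mk = QuotientAddGroup.mk ∘ Φ.F := funext Φ.lift
  rw [hlift]
  exact (AddCircle.continuous_mk' 2).comp Φ.smooth.continuous

lemma Icc_subset (i : Fin k) :
    Icc ((Φ.P i).c - (Φ.P i).r) ((Φ.P i).c + (Φ.P i).r) ⊆ Icc (-1) (-1 + 2) := by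
  induction i using WellFoundedLT.induction with
  | ind i ih =>
    rcases eq_or_ne i 0 with rfl | hi
    · rw [Φ.center_zero, Φ.radius_zero]
      norm_num
    · calc Icc ((Φ.P i).c - (Φ.P i).r) ((Φ.P i).c + (Φ.P i).r)
          ⊆ (Φ.P (Φ.host i)).gap (Φ.hostWord i) (Φ.hostGen i) := Φ.sub_host i hi
        _ ⊆ (Φ.P (Φ.host i)).atom (Φ.hostWord i) (Φ.hostGen i) := (Φ.P _).gap_subset_atom _ _
        _ ⊆ (Φ.P (Φ.host i)).atom (Φ.hostWord i) 0 := (Φ.P _).atom_antitone _ (Nat.zero_le _)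
        _ ⊆ Icc (-1) (-1 + 2) := ih _ (Φ.host_lt i hi)

lemma f_coe (i : Fin k) {x : ℝ} (hx : x ∈ (Φ.P i).cantor) : Φ.f (x : Circ) = (Φ.G i x : Circ) := by
  refine Φ.agree i x ((Φ.P i).cantor_subset_piece hx) fun j _ _ => ?_
  obtain ⟨a, rfl⟩ := (Φ.P i).range_code.ge hx
  exact (Φ.P i).code_notMem_gap a _ _

lemma isCircleModel (i : Fin k) : IsCircleModel (Φ.P i) (Φ.G i) Φ.f where
  measurable := Φ.continuous_f.measurable
  Icc_subset := Φ.Icc_subset i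
  gapMap := (Φ.bowen i).isGapMap
  coe_eq _ := Φ.f_coe i

end BowenCircleMap

end BowenTorus

end

open BowenTorus in
theorem mainTheorem8_general {P Q : CantorData} {G₁ G₂ : ℝ → ℝ} {f₁ f₂ : Circ → Circ}
    (h₁ : IsCircleModel P G₁ f₁) (h₂ : IsCircleModel Q G₂ f₂) :
    let f : Circ × Circ → Circ × Circ := torusMap f₁ f₂
    let KT : Set (Circ × Circ) := P.cantorCirc ×ˢ Q.cantorCirc
    let μ : Measure (Circ × Circ) :=
      (cond volume P.cantorCirc).prod (cond volume Q.cantorCirc)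
    let a : Circ → ℕ → Fin 2 := itin f₁ (P.pieceCirc 1)
    let b : Circ → ℕ → Fin 2 := itin f₂ (Q.pieceCirc 1)
    let h : Circ × Circ → ℕ → Fin 4 := pairItin a b
    let E : Set (Circ × Circ) := regularTorus P Q f₁ f₂
    let KI : Set (ℝ × ℝ) := P.cantor ×ˢ Q.cantor
    let μI : Measure (ℝ × ℝ) :=
      (cond volume P.cantor).prod (cond volume Q.cantor)
    let G : ℝ × ℝ → ℝ × ℝ := Prod.map G₁ G₂
    let aI : ℝ → ℕ → Fin 2 := itin G₁ (P.piece 1)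
    let bI : ℝ → ℕ → Fin 2 := itin G₂ (Q.piece 1)
    let hI : ℝ × ℝ → ℕ → Fin 4 := pairItin aI bI
    (IsProbabilityMeasure μ ∧ μ KTᶜ = 0 ∧ MeasurePreserving f μ μ) ∧
    ((∀ p ∈ KI, G p ∈ KI ∧
        f ((p.1 : Circ), (p.2 : Circ)) = (((G p).1 : Circ), ((G p).2 : Circ))) ∧
      (∀ p ∈ KI, ∀ n : ℕ, G₁^[n] p.1 ∈ P.piece (aI p.1 n) ∧ G₂^[n] p.2 ∈ Q.piece (bI p.2 n)) ∧
      (∀ p ∈ KI, hI (G p) = shift (hI p)) ∧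
      ∃ H : KI ≃ᵐ (ℕ → Fin 4), (∀ p : KI, H p = hI p) ∧
        MeasurePreserving H (μI.comap Subtype.val) bernoulliFour) ∧
    ((∀ p ∈ KT, ∀ n : ℕ, f₁^[n] p.1 ∈ P.pieceCirc (a p.1 n) ∧
        f₂^[n] p.2 ∈ Q.pieceCirc (b p.2 n)) ∧
      (∀ p ∈ KT, h (f p) = shift (h p)) ∧
      MeasurePreserving h μ bernoulliFour ∧
      MeasurableSet E ∧ μ Eᶜ = 0 ∧ MapsTo f E E ∧ InjOn h E ∧
      (∀ B ⊆ E, MeasurableSet B → MeasurableSet (h '' B)) ∧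
      bernoulliFour (h '' E)ᶜ = 0) := by
  intro f KT μ a b h E KI μI G aI bI hI
  have := h₁.isProbabilityMeasure
  have := h₂.isProbabilityMeasure
  have hC := measurePreserving_pairCode h₁.measurePreserving_codeCirc
    h₂.measurePreserving_codeCirc
  have hf : MeasurePreserving f μ μ := h₁.measurePreserving.prod h₂.measurePreserving
  have hh : Measurable h := measurable_pairItin h₁.measurable_itin h₂.measurable_itin
  have hE_range : E ⊆ range _ := regularTorus_subset_range_pairCode
  have hE_inv : LeftInvOn h _ (_ ⁻¹' E) := h₁.leftInvOn_pairItin_pairCode h₂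
  have hE_meas : MeasurableSet E :=
    measurableSet_regularTorus h₁.measurable h₂.measurable
  have hE_ae : ∀ᵐ p ∂μ, p ∈ E := h₁.ae_mem_regularTorus h₂
  refine ⟨⟨inferInstance, hE_ae.mono fun p hp => hp.1, hf⟩,
    ⟨fun p hp => ⟨⟨h₁.gapMap.mapsTo_cantor hp.1, h₂.gapMap.mapsTo_cantor hp.2⟩,
        Prod.ext (h₁.coe_eq _ hp.1) (h₂.coe_eq _ hp.2)⟩,
      fun p hp n => ⟨h₁.gapMap.iterate_mem_piece hp.1 n, h₂.gapMap.iterate_mem_piece hp.2 n⟩,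
      fun p _ => rfl, h₁.gapMap.exists_measurableEquiv_prod h₂.gapMap⟩,
    fun p hp n => ⟨h₁.iterate_mem_pieceCirc hp.1 n, h₂.iterate_mem_pieceCirc hp.2 n⟩,
    fun p _ => rfl, measurePreserving_of_leftInvOn_preimage hC hh hE_inv hE_ae,
    hE_meas, hE_ae, mapsTo_orbitsIn (h₁.mapsTo_cantorCirc.prodMap h₂.mapsTo_cantorCirc),
    injOn_of_leftInvOn_preimage hE_range hE_inv,
    fun B hB => measurableSet_image_of_leftInvOn_preimage hC.measurable
      (hB.trans hE_range) (hE_inv.mono (preimage_mono hB)),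
    ae_mem_image_of_leftInvOn_preimage hC hE_range hE_inv hE_ae⟩

/-- `Φ.f` is the circle map with one Cantor set, `Ψ.f` the circle map with `k` Cantor sets, `f` their
product, `KT` the `i`-th Cantor set in the torus, `μ` the product measure, `h` the combined itinerary
map on the torus, `E` the set of points of `KT` whose orbit never has a coordinate at the
point `-1 ∼ 1`, and `KI`, `μI`, `G`, `hI` the Cantor set, measure, map and combined itinerary in the
square `[-1, 1] × [-1, 1]`, before its sides are identified. -/
theorem mainTheorem8 (k : ℕ) [NeZero k] (Φ : BowenTorus.BowenCircleMap 1)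
    (Ψ : BowenTorus.BowenCircleMap k) (i : Fin k) :
    let f : BowenTorus.Circ × BowenTorus.Circ → BowenTorus.Circ × BowenTorus.Circ :=
      BowenTorus.torusMap Φ.f Ψ.f
    let KT : Set (BowenTorus.Circ × BowenTorus.Circ) := Φ.K 0 ×ˢ Ψ.K i
    let μ : Measure (BowenTorus.Circ × BowenTorus.Circ) := (Φ.μ 0).prod (Ψ.μ i)
    let a : BowenTorus.Circ → ℕ → Fin 2 := BowenTorus.itin Φ.f (Φ.pieceCirc 0 1)
    let b : BowenTorus.Circ → ℕ → Fin 2 := BowenTorus.itin Ψ.f (Ψ.pieceCirc i 1)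
    let h : BowenTorus.Circ × BowenTorus.Circ → ℕ → Fin 4 :=
      fun p => BowenTorus.pairSeq (a p.1) (b p.2)
    let E : Set (BowenTorus.Circ × BowenTorus.Circ) :=
      {p ∈ KT | ∀ n : ℕ, (f^[n] p).1 ≠ ((1 : ℝ) : BowenTorus.Circ) ∧
        (f^[n] p).2 ≠ ((1 : ℝ) : BowenTorus.Circ)}
    let KI : Set (ℝ × ℝ) := (Φ.P 0).cantor ×ˢ (Ψ.P i).cantor
    let μI : Measure (ℝ × ℝ) :=
      (ProbabilityTheory.cond volume (Φ.P 0).cantor).prod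
        (ProbabilityTheory.cond volume (Ψ.P i).cantor)
    let G : ℝ × ℝ → ℝ × ℝ := fun p => (Φ.G 0 p.1, Ψ.G i p.2)
    let aI : ℝ → ℕ → Fin 2 := BowenTorus.itin (Φ.G 0) ((Φ.P 0).piece 1)
    let bI : ℝ → ℕ → Fin 2 := BowenTorus.itin (Ψ.G i) ((Ψ.P i).piece 1)
    let hI : ℝ × ℝ → ℕ → Fin 4 := fun p => BowenTorus.pairSeq (aI p.1) (bI p.2)
    -- `μ` is an `f`-invariant probability measure carried by `KT`
    (IsProbabilityMeasure μ ∧ μ KTᶜ = 0 ∧ MeasurePreserving f μ μ) ∧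
    -- in the square, the combined itinerary is an everywhere defined bimeasurable conjugation
    ((∀ p ∈ KI, G p ∈ KI ∧
        f ((p.1 : BowenTorus.Circ), (p.2 : BowenTorus.Circ)) =
          (((G p).1 : BowenTorus.Circ), ((G p).2 : BowenTorus.Circ))) ∧
      (∀ p ∈ KI, ∀ n : ℕ, (Φ.G 0)^[n] p.1 ∈ (Φ.P 0).piece (aI p.1 n) ∧
        (Ψ.G i)^[n] p.2 ∈ (Ψ.P i).piece (bI p.2 n)) ∧
      (∀ p ∈ KI, hI (G p) = BowenTorus.shift (hI p)) ∧
      ∃ H : KI ≃ᵐ (ℕ → Fin 4), (∀ p : KI, H p = hI p) ∧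
        MeasurePreserving H (μI.comap Subtype.val) BowenTorus.bernoulliFour) ∧
    -- on the torus, it is a bimeasurable conjugation on the set `E` of full measure
    ((∀ p ∈ KT, ∀ n : ℕ, Φ.f^[n] p.1 ∈ Φ.pieceCirc 0 (a p.1 n) ∧
        Ψ.f^[n] p.2 ∈ Ψ.pieceCirc i (b p.2 n)) ∧
      (∀ p ∈ KT, h (f p) = BowenTorus.shift (h p)) ∧
      MeasurePreserving h μ BowenTorus.bernoulliFour ∧
      MeasurableSet E ∧ μ Eᶜ = 0 ∧ MapsTo f E E ∧ InjOn h E ∧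
      (∀ B ⊆ E, MeasurableSet B → MeasurableSet (h '' B)) ∧
      BowenTorus.bernoulliFour (h '' E)ᶜ = 0) :=
  mainTheorem8_general (Φ.isCircleModel 0) (Ψ.isCircleModel i)
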